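/- Let $\hat\theta_n$, $\hat\sigma_n\ge 0$ and $\hat\lambda_n$ ($n=0,1,2,\dots$) be real random variables on a probability space, let $\theta_\pi\in\mathbb R$, $\sigma_\theta>0$, $\lambda_\theta>0$ and $0<\delta<1$, and let $z_{\delta/2}$ be the $(1-\delta/2)$-quantile of the standard normal distribution. Let $p$ be a real function on the natural numbers with $p(n)>0$ for $n\ge 1$ and $p(n)=o(n^{-1/2})$ as $n\to\infty$. For $\epsilon>0$ and $n\ge 1$ put \[ T_3(\epsilon)=\inf\Bigl\{n\ge 1:\ \frac{2z_{\delta/2}\hat\sigma_n}{\sqrt n}+p(n)\le \epsilon\hat\lambda_n\Bigr\}\in\{1,2,\dots\}\cup\{\infty\}, \qquad C[n]=\Bigl(\hat\theta_n-\frac{z_{\delta/2}\hat\sigma_n}{\sqrt n},\ \hat\theta_n+\frac{z_{\delta/2}\hat\sigma_n}{\sqrt n}\Bigr). \] Assume that the functional central limit theorem holds for $\sqrt n(\hat\theta_n-\theta_\pi)\to N(0,\sigma_\theta^2)$: if $Y_n$ is the continuous, piecewise linear process on $(0,\infty)$ with $Y_n(k/n)=k(\hat\theta_k-\theta_\pi)/\sqrt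 n$ for $k\ge1$ (with $Y_n(t)\to 0$ as $t\to0$, and linear between consecutive points $k/n$, $k\ge 0$), then $Y_n\Rightarrow\sigma_\theta B$ as $n\to\infty$, where $B$ is a standard Brownian motion and the convergence is in distribution in the space of continuous functions on $(0,\infty)$ with uniform convergence on compact subsets. (This is implied by the same convergence on $[0,\infty)$.) Assume also that $\hat\lambda_n\to\lambda_\theta$ and $\hat\sigma_n\to\sigma_\theta$ almost surely as $n\to\infty$. Then, with probability one, the simulation terminates, that is, $T_3(\epsilon)<\infty$ for every $\epsilon>0$; and \[ \Pr\bigl(T_3(\epsilon)<\infty,\ \theta_\pi\in C[T_3(\epsilon)]\bigr)\to 1-\delta\qquad\text{as }\epsilon\to0^+ . \] -/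

import Mathlib

open MeasureTheory ProbabilityTheory Filter Topology
open scoped NNReal

noncomputable section

namespace FixedWidth

/-- Spaces of continuous real functions carry the topology of uniform convergence on compact sets
(the compact-open topology) and the Borel σ-algebra of that topology. -/
instance instMeasurableSpaceContinuousMap {X : Type*} [TopologicalSpace X] :
    MeasurableSpace C(X, ℝ) := borel _

instance instBorelSpaceContinuousMap {X : Type*} [TopologicalSpace X] :
    BorelSpace C(X, ℝ) := ⟨rfl⟩

/-- The piecewise linear interpolation on `[0, ∞)` of a real sequence, with value `a k` at `k`. -/
def linInterp (a : ℕ → ℝ) (x : ℝ≥0) : ℝ :=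
  a ⌊x⌋₊ + ((x : ℝ) - (⌊x⌋₊ : ℝ)) * (a (⌊x⌋₊ + 1) - a ⌊x⌋₊)

theorem continuous_linInterp (a : ℕ → ℝ) : Continuous (linInterp a) := by
  have hlf : LocallyFinite fun k : ℕ => Set.Icc (k : ℝ≥0) (k + 1) := by
    intro x
    refine ⟨Set.Iio (x + 1), Iio_mem_nhds (by simp), ?_⟩
    refine (Set.finite_Iic (⌊x + 1⌋₊)).subset ?_
    rintro k ⟨y, ⟨hy, -⟩, hy'⟩
    exact Nat.le_floor (hy.trans (le_of_lt hy'))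
  refine hlf.continuous ?_ (fun _ => isClosed_Icc) fun k => ?_
  · refine Set.eq_univ_of_forall fun x => Set.mem_iUnion.2 ⟨⌊x⌋₊, ?_, ?_⟩
    · exact Nat.floor_le zero_le
    · exact (Nat.lt_floor_add_one x).le
  · have hc : ContinuousOn (fun x : ℝ≥0 => a k + ((x : ℝ) - (k : ℝ)) * (a (k + 1) - a k))
        (Set.Icc (k : ℝ≥0) (k + 1)) := by fun_prop
    refine hc.congr ?_
    rintro x ⟨h1, h2⟩
    rcases h2.lt_or_eq with h | h
    · have : ⌊x⌋₊ = k := (Nat.floor_eq_iff zero_le).2 ⟨h1, h⟩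
      simp [linInterp, this]
    · have hf : ⌊x⌋₊ = k + 1 := by
        rw [h]; exact_mod_cast Nat.floor_natCast (R := ℝ≥0) (k + 1)
      have hx : (x : ℝ) = k + 1 := by rw [h]; push_cast; rfl
      simp only [linInterp, hf, hx]
      push_cast
      ring

variable {Ω : Type*}

/-- The normalized error process of the estimators `est 1, est 2, …` of `θ`: the continuous path on
`(0, ∞)` with value `k * (est k - θ) / √n` at the time `k / n`, linear in between. If `est k` is the
mean of `k` observations, this is the normalized partial sum process of Donsker's theorem. -/
def errorProcess (est : ℕ → Ω → ℝ) (θ : ℝ) (n : ℕ) (ω : Ω) : C(Set.Ioi (0 : ℝ≥0), ℝ) where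
  toFun t := linInterp (fun k => (k : ℝ) * (est k ω - θ)) ((n : ℝ≥0) * t.1) / √(n : ℝ)
  continuous_toFun :=
    ((continuous_linInterp _).comp (continuous_const.mul continuous_subtype_val)).div_const _

/-- The functional central limit theorem for `√n (est n - θ) → N(0, σ²)`: the normalized error
processes converge in distribution to `σ` times a standard Brownian motion, in the space of
continuous functions on `(0, ∞)`. Here `ν` is Wiener measure. -/
def FunctionalCLT [MeasurableSpace Ω] (P : Measure Ω) [IsProbabilityMeasure P]
    (est : ℕ → Ω → ℝ) (θ σ : ℝ) : Prop :=
  ∃ ν : ProbabilityMeasure C(ℝ≥0, ℝ),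
    IsBrownianReal (fun t (w : C(ℝ≥0, ℝ)) => w t) (ν : Measure C(ℝ≥0, ℝ)) ∧
    TendstoInDistribution (errorProcess est θ) atTop
      (fun w : C(ℝ≥0, ℝ) => (σ • w).restrict (Set.Ioi (0 : ℝ≥0)))
      (fun _ => P) (ν : Measure C(ℝ≥0, ℝ))

/-- The critical value `z_α` of the standard normal distribution: its `(1 - α)`-quantile. -/
def critVal (α : ℝ) : ℝ := sInf {x : ℝ | 1 - α ≤ cdf (gaussianReal 0 1) x}

/-- The confidence interval
`C[n] = (est n - z_{δ/2} σhat n / √n, est n + z_{δ/2} σhat n / √n)`. -/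
def confInterval (δ : ℝ) (est σhat : ℕ → Ω → ℝ) (n : ℕ) (ω : Ω) : Set ℝ :=
  Set.Ioo (est n ω - critVal (δ / 2) * σhat n ω / √(n : ℝ))
    (est n ω + critVal (δ / 2) * σhat n ω / √(n : ℝ))

/-- The relative standard deviation stopping rule
`T₃(ε) = inf {n : 2 z_{δ/2} σhat n / √n + p n ≤ ε λhat n}`, with value `⊤` if the simulation never
stops. The sample size `n = 0`, where the width is not defined, is left out. -/
def T₃ (δ : ℝ) (σhat lamhat : ℕ → Ω → ℝ) (p : ℕ → ℝ) (ε : ℝ) (ω : Ω) : ℕ∞ :=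
  ⨅ n ∈ {n : ℕ | 1 ≤ n ∧
    2 * critVal (δ / 2) * σhat n ω / √(n : ℝ) + p n ≤ ε * lamhat n ω}, (n : ℕ∞)

end FixedWidth

end

/-! ### Convergence in measure and evaluation at a random time -/

/-! Along almost every path `√n` times the width tends to `2zσ`, because `p n = o(n^(-1/2))`. Hence
the rule stops at a finite `T`, and minimality of `T` gives `ε√T → c = 2zσ/λ`
(`tendsto_mul_sqrt_sInf_stopSet`). So `T/N → 1` for the deterministic size `N ~ (c/ε)²` (`refSize`).
An ordinary central limit theorem says nothing at the random index `T`, but the functional one does: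
`T(est T - θ)/√N` is the value of the process `Y_N` at the time `T/N`. Convergence in distribution
of continuous paths controls their oscillation near time 1, so this value is `Y_N(1) + o_P(1)`
(`tendstoInMeasure_eval_sub_eval`) and tends to `σB(1)` in law. Coverage is the event `|Y_N(T/N)| <
z σhat_T √(T/N)` (`mem_confInterval_iff`), so Slutsky and portmanteau give the limit `P(|B(1)| < z)
= 1 - δ` (`tendsto_coverage`). -/

theorem tendstoInMeasure_of_tendsto_ae_filter {α E ι : Type*} [MeasurableSpace α] {μ : Measure α}
    [IsFiniteMeasure μ] [PseudoEMetricSpace E] {l : Filter ι} [l.IsCountablyGenerated]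
    {f : ι → α → E} {g : α → E} (hf : ∀ i, AEStronglyMeasurable (f i) μ)
    (hfg : ∀ᵐ x ∂μ, Tendsto (fun i => f i x) l (𝓝 (g x))) : TendstoInMeasure μ f l g := by
  intro ε hε
  -- Countable generation of `l` reduces the limit to sequences; this covers `ε → 0⁺`.
  refine tendsto_of_seq_tendsto fun u hu => ?_
  exact tendstoInMeasure_of_tendsto_ae (f := fun n => f (u n)) (fun n => hf _)
    (hfg.mono fun x hx => hx.comp hu) ε hε

/-- The oscillation of a function around `x₀`, over a set `K`. -/
noncomputable def oscOn {X : Type*} [TopologicalSpace X] (x₀ : X) (K : Set X) (f : C(X, ℝ)) : ℝ :=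
  sSup ((fun x => |f x - f x₀|) '' K)

/-- Local compactness makes evaluation jointly continuous, and a supremum over a compact set
preserves continuity in the parameter. -/
theorem continuous_oscOn {X : Type*} [TopologicalSpace X] [LocallyCompactSpace X] (x₀ : X)
    {K : Set X} (hK : IsCompact K) : Continuous (oscOn x₀ K) := by
  refine hK.continuous_sSup (f := fun (f : C(X, ℝ)) x => |f x - f x₀|) ?_
  simp only [Function.HasUncurry.uncurry, id]
  fun_prop

theorem le_oscOn {X : Type*} [TopologicalSpace X] (x₀ : X) {K : Set X} (hK : IsCompact K)
    (f : C(X, ℝ)) {x : X} (hx : x ∈ K) : |f x - f x₀| ≤ oscOn x₀ K f :=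
  le_csSup (hK.image (by fun_prop)).bddAbove (Set.mem_image_of_mem _ hx)

theorem tendsto_oscOn_closedBall {X : Type*} [PseudoMetricSpace X] (x₀ : X) (f : C(X, ℝ))
    {r : ℕ → ℝ} (hr : ∀ j, 0 ≤ r j) (hr0 : Tendsto r atTop (𝓝 0)) :
    Tendsto (fun j => oscOn x₀ (Metric.closedBall x₀ (r j)) f) atTop (𝓝 0) := by
  rw [Metric.tendsto_nhds]
  intro e he
  obtain ⟨d, hd, hfd⟩ := Metric.continuous_iff.1 f.continuous x₀ (e / 2) (by positivity)
  filter_upwards [hr0.eventually_lt_const hd] with j hj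
  have h0 : 0 ≤ oscOn x₀ (Metric.closedBall x₀ (r j)) f := by
    refine Real.sSup_nonneg ?_
    rintro _ ⟨x, -, rfl⟩
    positivity
  rw [Real.dist_eq, sub_zero, abs_of_nonneg h0]
  refine lt_of_le_of_lt (csSup_le ?_ ?_) (half_lt_self he)
  · exact (Metric.nonempty_closedBall.2 (hr j)).image _
  · rintro _ ⟨x, hx, rfl⟩
    have := hfd x (lt_of_le_of_lt hx hj)
    rw [Real.dist_eq] at this
    exact this.le

/-- If random continuous functions converge in distribution, then their values at random points that
converge in probability to `x₀` are asymptotically equivalent to their values at `x₀`. -/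
theorem tendstoInMeasure_eval_sub_eval {Ω Ω' X ι : Type*} [MeasurableSpace Ω] [MeasurableSpace Ω']
    {P : Measure Ω} [IsProbabilityMeasure P] {P' : Measure Ω'} [IsProbabilityMeasure P']
    [PseudoMetricSpace X] [LocallyCompactSpace X] {l : Filter ι} [l.IsCountablyGenerated]
    {Y : ι → Ω → C(X, ℝ)} {Z : Ω' → C(X, ℝ)} {τ : ι → Ω → X} {x₀ : X}
    (hY : TendstoInDistribution Y l Z (fun _ => P) P')
    (hτ : TendstoInMeasure P τ l (fun _ => x₀)) :
    TendstoInMeasure P (fun i ω => Y i ω (τ i ω) - Y i ω x₀) l 0 := by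
  obtain ⟨R, hR, hRc⟩ := Metric.exists_isCompact_closedBall x₀
  set r : ℕ → ℝ := fun j => R * (1 / ((j : ℝ) + 1)) with hrdef
  have hr_pos : ∀ j, 0 < r j := fun j => by simp only [hrdef]; positivity
  have hr0 : Tendsto r atTop (𝓝 0) := by
    have h := (tendsto_one_div_add_atTop_nhds_zero_nat (𝕜 := ℝ)).const_mul R
    rwa [mul_zero] at h
  have hK : ∀ j, IsCompact (Metric.closedBall x₀ (r j)) := fun j => by
    refine hRc.of_isClosed_subset Metric.isClosed_closedBall (Metric.closedBall_subset_closedBall ?_)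
    refine mul_le_of_le_one_right hR.le ?_
    rw [div_le_one (by positivity)]
    linarith [Nat.cast_nonneg (α := ℝ) j]
  have hosc : TendstoInMeasure P' (fun j ω => oscOn x₀ (Metric.closedBall x₀ (r j)) (Z ω)) atTop
      (fun _ => (0 : ℝ)) :=
    tendstoInMeasure_of_tendsto_ae
      (fun j => ((continuous_oscOn x₀ (hK j)).measurable.comp_aemeasurable
        hY.aemeasurable_limit).aestronglyMeasurable)
      (.of_forall fun ω => tendsto_oscOn_closedBall x₀ (Z ω) (fun j => (hr_pos j).le) hr0)
  rw [tendstoInMeasure_iff_dist] at hosc hτ ⊢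
  intro κ hκ
  rw [ENNReal.tendsto_nhds_zero]
  intro d hd
  have hd2 : 0 < d / 2 := ENNReal.half_pos hd.ne'
  -- The radius is chosen from the limit `Z` alone; portmanteau on the closed set `[κ, ∞)` then
  -- transfers the oscillation bound to `Y i`.
  obtain ⟨j, hj⟩ := ((hosc κ hκ).eventually_lt_const hd2).exists
  have hYj := hY.continuous_comp (continuous_oscOn x₀ (hK j))
  have hlim := ProbabilityMeasure.limsup_measure_closed_le_of_tendsto hYj.tendsto
    (isClosed_Ici (a := κ))
  have hlt : (P'.map (oscOn x₀ (Metric.closedBall x₀ (r j)) ∘ Z)) (Set.Ici κ) < d / 2 := by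
    rw [Measure.map_apply_of_aemeasurable hYj.aemeasurable_limit measurableSet_Ici]
    refine lt_of_le_of_lt (measure_mono fun ω hω => ?_) hj
    simp only [Set.mem_ofPred_eq, Real.dist_eq, sub_zero]
    exact le_trans hω (le_abs_self _)
  have hev := eventually_lt_of_limsup_lt (lt_of_le_of_lt hlim hlt)
  filter_upwards [hev, (hτ (r j) (hr_pos j)).eventually_lt_const hd2] with i hi1 hi2
  simp only [ProbabilityMeasure.coe_mk] at hi1
  rw [Measure.map_apply_of_aemeasurable (hYj.forall_aemeasurable i) measurableSet_Ici] at hi1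
  calc P {ω | κ ≤ dist (Y i ω (τ i ω) - Y i ω x₀) ((0 : Ω → ℝ) ω)}
      ≤ P ((oscOn x₀ (Metric.closedBall x₀ (r j)) ∘ Y i) ⁻¹' Set.Ici κ
          ∪ {ω | r j ≤ dist (τ i ω) x₀}) := by
        refine measure_mono fun ω hω => ?_
        by_cases h : r j ≤ dist (τ i ω) x₀
        · exact Or.inr h
        · refine Or.inl (le_trans ?_ (le_oscOn x₀ (hK j) (Y i ω) (not_le.1 h).le))
          simpa [Real.dist_eq] using hω
    _ ≤ _ := measure_union_le _ _
    _ ≤ d / 2 + d / 2 := add_le_add hi1.le hi2.le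
    _ = d := ENNReal.add_halves d

/-! ### The first index at which a random condition holds -/

theorem measurable_sInf_nat {Ω : Type*} [MeasurableSpace Ω] {S : Ω → Set ℕ}
    (hS : ∀ n, MeasurableSet {ω | n ∈ S ω}) : Measurable fun ω => sInf (S ω) := by
  refine measurable_to_countable' fun n => ?_
  -- The second set accounts for `sInf ∅ = 0`.
  have : (fun ω => sInf (S ω)) ⁻¹' {n} = ({ω | n ∈ S ω} ∩ ⋂ m ∈ Set.Iio n, {ω | m ∈ S ω}ᶜ) ∪
      ({_ω | n = 0} ∩ ⋂ m, {ω | m ∈ S ω}ᶜ) := by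
    ext ω
    simp only [Set.mem_preimage, Set.mem_singleton_iff, Set.mem_union, Set.mem_inter_iff,
      Set.mem_iInter, Set.mem_compl_iff, Set.mem_ofPred_eq, Set.mem_Iio]
    constructor
    · rintro rfl
      rcases (S ω).eq_empty_or_nonempty with h | h
      · right; simp [h]
      · exact Or.inl ⟨Nat.sInf_mem h, fun m hm => Nat.notMem_of_lt_sInf hm⟩
    · rintro (⟨h1, h2⟩ | ⟨h1, h2⟩)
      · refine le_antisymm (Nat.sInf_le h1) (not_lt.1 fun h => h2 _ h (Nat.sInf_mem ⟨n, h1⟩))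
      · rw [h1, Set.eq_empty_iff_forall_notMem.2 h2, Nat.sInf_empty]
  rw [this]
  refine ((hS n).inter (.biInter (Set.to_countable _) fun m _ => (hS m).compl)).union
    ((MeasurableSet.const _).inter (.iInter fun m => (hS m).compl))

theorem measurable_eval_nat {Ω : Type*} [MeasurableSpace Ω] {f : ℕ → Ω → ℝ}
    (hf : ∀ n, Measurable (f n)) {T : Ω → ℕ} (hT : Measurable T) :
    Measurable fun ω => f (T ω) ω :=
  (measurable_from_prod_countable_right (f := fun x : ℕ × Ω => f x.1 x.2) hf).comp
    (hT.prodMk measurable_id)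

/-- The sample sizes `n ≥ 1` at which the tolerance `ε L n` is at least the width `A n`. -/
def stopSet (A L : ℕ → ℝ) (ε : ℝ) : Set ℕ := {n | 1 ≤ n ∧ A n ≤ ε * L n}

/-! ### Asymptotics of the stopping time along a fixed path -/

section StopSet

variable {A L : ℕ → ℝ} {a b : ℝ}

theorem tendsto_zero_of_sqrt_mul (hA : Tendsto (fun n : ℕ => √(n : ℝ) * A n) atTop (𝓝 a)) :
    Tendsto A atTop (𝓝 0) := by
  have hs : Tendsto (fun n : ℕ => (√(n : ℝ))⁻¹) atTop (𝓝 0) :=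
    tendsto_inv_atTop_zero.comp (Real.tendsto_sqrt_atTop.comp tendsto_natCast_atTop_atTop)
  have := hs.mul hA
  rw [zero_mul] at this
  refine this.congr' ?_
  filter_upwards [eventually_gt_atTop 0] with n hn
  have : √(n : ℝ) ≠ 0 := by positivity
  field_simp

theorem stopSet_nonempty (hA : Tendsto (fun n : ℕ => √(n : ℝ) * A n) atTop (𝓝 a))
    (hL : Tendsto L atTop (𝓝 b)) (hb : 0 < b) {ε : ℝ} (hε : 0 < ε) : (stopSet A L ε).Nonempty := by
  have h := (tendsto_zero_of_sqrt_mul hA).eventually_lt (hL.const_mul ε) (by positivity)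
  obtain ⟨n, h1, h2⟩ := (h.and (eventually_ge_atTop 1)).exists
  exact ⟨n, h2, h1.le⟩

/-- Since each width is positive, none of the finitely many sizes below `m` qualifies once `ε` is
small. -/
theorem tendsto_sInf_stopSet (hpos : ∀ n, 1 ≤ n → 0 < A n)
    (hA : Tendsto (fun n : ℕ => √(n : ℝ) * A n) atTop (𝓝 a))
    (hL : Tendsto L atTop (𝓝 b)) (hb : 0 < b) :
    Tendsto (fun ε => sInf (stopSet A L ε)) (𝓝[>] 0) atTop := by
  rw [tendsto_atTop]
  intro m
  have h : ∀ᶠ ε in 𝓝[>] (0 : ℝ), ∀ n ∈ Finset.Ico 1 m, ε * L n < A n := by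
    rw [eventually_all_finset]
    intro n hn
    have : Tendsto (fun ε => ε * L n) (𝓝 (0 : ℝ)) (𝓝 (0 * L n)) := tendsto_id.mul_const _
    rw [zero_mul] at this
    exact (this.mono_left nhdsWithin_le_nhds).eventually_lt_const (hpos n (Finset.mem_Ico.1 hn).1)
  filter_upwards [h, self_mem_nhdsWithin] with ε hε hε0
  have hmem := Nat.sInf_mem (stopSet_nonempty hA hL hb hε0)
  by_contra! hlt
  exact absurd hmem.2 (not_le.2 (hε _ (Finset.mem_Ico.2 ⟨hmem.1, hlt⟩)))

/-- Write `T` for the infimum. The inequality at `T` bounds `ε√T` below by `√T A_T / L_T`; its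
failure at `T - 1` bounds `ε√T` above by the same expression at `T - 1` times `√(T/(T-1))`. Both
bounds tend to `a / b`. -/
theorem tendsto_mul_sqrt_sInf_stopSet (hpos : ∀ n, 1 ≤ n → 0 < A n)
    (hA : Tendsto (fun n : ℕ => √(n : ℝ) * A n) atTop (𝓝 a))
    (hL : Tendsto L atTop (𝓝 b)) (hb : 0 < b) :
    Tendsto (fun ε => ε * √((sInf (stopSet A L ε) : ℕ) : ℝ)) (𝓝[>] 0) (𝓝 (a / b)) := by
  have hT := tendsto_sInf_stopSet hpos hA hL hb
  have hT' : Tendsto (fun ε => sInf (stopSet A L ε) - 1) (𝓝[>] 0) atTop :=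
    (tendsto_sub_atTop_nat 1).comp hT
  have hg : Tendsto (fun n : ℕ => √(n : ℝ) * A n / L n) atTop (𝓝 (a / b)) := hA.div hL hb.ne'
  have hratio : Tendsto (fun n : ℕ => √(((n + 1 : ℕ) : ℝ) / n)) atTop (𝓝 1) := by
    have h1 : Tendsto (fun n : ℕ => 1 + 1 / (n : ℝ)) atTop (𝓝 (1 + 0)) :=
      tendsto_const_nhds.add tendsto_one_div_atTop_nhds_zero_nat
    have h2 := (Real.continuous_sqrt.tendsto _).comp h1
    rw [add_zero, Real.sqrt_one] at h2
    refine h2.congr' ?_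
    filter_upwards [eventually_gt_atTop 0] with n hn
    have : (n : ℝ) ≠ 0 := by positivity
    simp only [Function.comp]
    congr 1
    push_cast
    field_simp
  have hup : Tendsto (fun n : ℕ => √(n : ℝ) * A n / L n * √(((n + 1 : ℕ) : ℝ) / n)) atTop
      (𝓝 (a / b)) := by simpa using hg.mul hratio
  have hLpos : ∀ᶠ n in atTop, 0 < L n := hL.eventually_const_lt hb
  refine tendsto_of_tendsto_of_tendsto_of_le_of_le' (hg.comp hT) (hup.comp hT') ?_ ?_
  · filter_upwards [hT.eventually hLpos, self_mem_nhdsWithin] with ε hLε hε0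
    have hmem := Nat.sInf_mem (stopSet_nonempty hA hL hb hε0)
    simp only [Function.comp]
    rw [div_le_iff₀ hLε]
    calc _ ≤ √((sInf (stopSet A L ε) : ℕ) : ℝ) * (ε * L (sInf (stopSet A L ε))) := by
          exact mul_le_mul_of_nonneg_left hmem.2 (Real.sqrt_nonneg _)
      _ = _ := by ring
  -- With `T ≥ 2`, the size `T - 1` satisfies `1 ≤ n`, so it is excluded by the width inequality
  -- itself.
  · filter_upwards [hT'.eventually hLpos, hT.eventually_ge_atTop 2] with ε hLε hT2
    obtain ⟨n, hn⟩ : ∃ n, sInf (stopSet A L ε) = n + 1 := ⟨sInf (stopSet A L ε) - 1, by omega⟩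
    have hn1 : 1 ≤ n := by omega
    have hnot : n ∉ stopSet A L ε := Nat.notMem_of_lt_sInf (by omega)
    have hlt : ε * L n < A n := by
      by_contra! h
      exact hnot ⟨hn1, h⟩
    simp only [Function.comp, hn, Nat.add_sub_cancel] at hLε ⊢
    have hn0 : 0 < √(n : ℝ) := by positivity
    rw [Real.sqrt_div (by positivity)]
    have h1 : ε ≤ A n / L n := by rw [le_div_iff₀ hLε]; exact hlt.le
    calc ε * √((n + 1 : ℕ) : ℝ) ≤ A n / L n * √((n + 1 : ℕ) : ℝ) := by gcongr
      _ = √(n : ℝ) * A n / L n * (√((n + 1 : ℕ) : ℝ) / √(n : ℝ)) := by field_simp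

end StopSet

/-! ### Normal critical values -/

theorem nullSingletonClass_stdGaussian : NullSingletonClass (gaussianReal 0 1) :=
  nullSingletonClass_gaussianReal one_ne_zero

theorem stdGaussian_real_Ioo_neg (x : ℝ) (hx : 0 ≤ x) :
    (gaussianReal 0 1).real (Set.Ioo (-x) x) = 2 * cdf (gaussianReal 0 1) x - 1 := by
  have := nullSingletonClass_stdGaussian
  have hsymm : (gaussianReal 0 1).real (Set.Iic (-x)) = (gaussianReal 0 1).real (Set.Ici x) := by
    have h := gaussianReal_map_neg (μ := 0) (v := 1)
    rw [neg_zero] at h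
    conv_lhs => rw [← h]
    rw [map_measureReal_apply measurable_neg measurableSet_Iic]
    congr 1
    ext y
    simp
  have hIci : (gaussianReal 0 1).real (Set.Ici x) = 1 - (gaussianReal 0 1).real (Set.Iic x) := by
    rw [← probReal_compl_eq_one_sub measurableSet_Iic, Set.compl_Iic]
    exact measureReal_congr Ioi_ae_eq_Ici.symm
  have hsplit : (gaussianReal 0 1).real (Set.Iic x) =
      (gaussianReal 0 1).real (Set.Iic (-x)) + (gaussianReal 0 1).real (Set.Ioc (-x) x) := by
    rw [← measureReal_union (Set.Iic_disjoint_Ioc le_rfl) measurableSet_Ioc,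
      Set.Iic_union_Ioc_eq_Iic (by linarith)]
  rw [measureReal_congr Ioo_ae_eq_Ioc, cdf_eq_real]
  linarith

/-- The jump of the distribution function at a point is the mass of that point, which is zero. -/
theorem continuous_cdf_stdGaussian : Continuous (cdf (gaussianReal 0 1)) := by
  have := nullSingletonClass_stdGaussian
  rw [continuous_iff_continuousAt]
  intro x
  rw [(monotone_cdf _).continuousAt_iff_leftLim_eq_rightLim, StieltjesFunction.rightLim_eq]
  have h := (cdf (gaussianReal 0 1)).measure_singleton x
  rw [measure_cdf, measure_singleton] at h
  have h2 := ENNReal.ofReal_eq_zero.1 h.symm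
  exact le_antisymm ((monotone_cdf _).leftLim_le le_rfl) (by linarith)

/-- The infimum is attained because the set is closed, which gives `≥`. To its left the distribution
function is below `1 - α`, and continuity gives `≤`. -/
theorem cdf_critVal {α : ℝ} (hα : α ∈ Set.Ioo (0 : ℝ) 1) :
    cdf (gaussianReal 0 1) (FixedWidth.critVal α) = 1 - α := by
  have hc := continuous_cdf_stdGaussian
  set F := cdf (gaussianReal 0 1) with hF
  have hmono : Monotone F := monotone_cdf _
  obtain ⟨u, hu⟩ := ((tendsto_cdf_atBot (gaussianReal 0 1)).eventually_lt_const
    (show 0 < 1 - α by linarith [hα.2])).exists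
  obtain ⟨v, hv⟩ := ((tendsto_cdf_atTop (gaussianReal 0 1)).eventually_const_lt
    (show 1 - α < 1 by linarith [hα.1])).exists
  have hbdd : BddBelow {x : ℝ | 1 - α ≤ F x} := ⟨u, fun x hx => by
    by_contra! h
    exact absurd (lt_of_le_of_lt (hx.trans (hmono h.le)) hu) (lt_irrefl _)⟩
  have hclosed : IsClosed {x : ℝ | 1 - α ≤ F x} := isClosed_le continuous_const hc
  have hmem := hclosed.csInf_mem ⟨v, hv.le⟩ hbdd
  refine le_antisymm ?_ hmem
  refine le_of_tendsto (hc.continuousWithinAt (s := Set.Iio (FixedWidth.critVal α))) ?_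
  filter_upwards [self_mem_nhdsWithin] with x hx
  by_contra! h
  exact absurd (csInf_le hbdd h.le) (not_le.2 hx)

theorem critVal_pos {α : ℝ} (hα : α ∈ Set.Ioo (0 : ℝ) (1 / 2)) : 0 < FixedWidth.critVal α := by
  have h := cdf_critVal (α := α) ⟨hα.1, by linarith [hα.2]⟩
  have h0 := stdGaussian_real_Ioo_neg 0 le_rfl
  simp only [neg_zero, Set.Ioo_self, measureReal_empty] at h0
  by_contra! hle
  have := monotone_cdf (gaussianReal 0 1) hle
  linarith [hα.2]

theorem stdGaussian_real_Ioo_critVal {δ : ℝ} (hδ : δ ∈ Set.Ioo (0 : ℝ) 1) :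
    (gaussianReal 0 1).real
      (Set.Ioo (-FixedWidth.critVal (δ / 2)) (FixedWidth.critVal (δ / 2))) = 1 - δ := by
  have h1 := critVal_pos (α := δ / 2) ⟨by linarith [hδ.1], by linarith [hδ.2]⟩
  rw [stdGaussian_real_Ioo_neg _ h1.le, cdf_critVal ⟨by linarith [hδ.1], by linarith [hδ.2]⟩]
  ring

namespace FixedWidth

/-! ### The stopping rule -/

/-- The width that the relative standard deviation rule compares with the tolerance. -/
noncomputable def ruleWidth (z : ℝ) (s p : ℕ → ℝ) (n : ℕ) : ℝ := 2 * z * s n / √(n : ℝ) + p n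

theorem ruleWidth_pos {z : ℝ} {s p : ℕ → ℝ} (hz : 0 ≤ z) (hs : ∀ n, 0 ≤ s n)
    (hp : ∀ n, 1 ≤ n → 0 < p n) (n : ℕ) (hn : 1 ≤ n) : 0 < ruleWidth z s p n := by
  have := hs n
  have := hp n hn
  rw [ruleWidth]
  positivity

theorem tendsto_sqrt_mul_ruleWidth (z : ℝ) {s p : ℕ → ℝ} {σ : ℝ} (hs : Tendsto s atTop (𝓝 σ))
    (hp : p =o[atTop] fun n : ℕ => (n : ℝ) ^ (-(1 / 2) : ℝ)) :
    Tendsto (fun n : ℕ => √(n : ℝ) * ruleWidth z s p n) atTop (𝓝 (2 * z * σ)) := by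
  have h := (hs.const_mul (2 * z)).add hp.tendsto_div_nhds_zero
  rw [add_zero] at h
  refine h.congr' ?_
  filter_upwards [eventually_gt_atTop 0] with n hn
  have h0 : 0 < √(n : ℝ) := by positivity
  rw [Real.rpow_neg (by positivity), ← Real.sqrt_eq_rpow, ruleWidth]
  field_simp

variable {Ω : Type*}

/-- Nonemptiness matters: the infimum of the empty set is `0` in `ℕ` but `⊤` in `ℕ∞`. -/
theorem T₃_eq_sInf {δ : ℝ} {σhat lamhat : ℕ → Ω → ℝ} {p : ℕ → ℝ} {ε : ℝ} {ω : Ω}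
    (h : (stopSet (ruleWidth (critVal (δ / 2)) (fun n => σhat n ω) p)
      (fun n => lamhat n ω) ε).Nonempty) :
    T₃ δ σhat lamhat p ε ω = (sInf (stopSet (ruleWidth (critVal (δ / 2)) (fun n => σhat n ω) p)
      (fun n => lamhat n ω) ε) : ℕ) :=
  (ENat.natCast_sInf h).symm

theorem linInterp_natCast (a : ℕ → ℝ) (k : ℕ) : linInterp a (k : ℝ≥0) = a k := by
  simp [linInterp]

theorem errorProcess_apply_div (est : ℕ → Ω → ℝ) (θ : ℝ) {n : ℕ} (hn : n ≠ 0) (k : ℕ) (ω : Ω)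
    (hk : (k : ℝ≥0) / n ∈ Set.Ioi 0) :
    errorProcess est θ n ω ⟨(k : ℝ≥0) / n, hk⟩ = k * (est k ω - θ) / √(n : ℝ) := by
  have h : (n : ℝ≥0) * ((k : ℝ≥0) / n) = k := mul_div_cancel₀ _ (by exact_mod_cast hn)
  change linInterp _ ((n : ℝ≥0) * ((k : ℝ≥0) / n)) / √(n : ℝ) = _
  rw [h, linInterp_natCast]

/-- Multiplying `|est k - θ| < z σhat k / √k` by `k / √N` puts the value at time `k / N` of the
error process of index `N` on the left. With `k` random and `N` deterministic, the functional limit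
theorem applies. -/
theorem mem_confInterval_iff {δ θ : ℝ} {est σhat : ℕ → Ω → ℝ} {ω : Ω} {N k : ℕ} (hN : N ≠ 0)
    (hk : k ≠ 0) :
    θ ∈ confInterval δ est σhat k ω ↔
      |k * (est k ω - θ) / √(N : ℝ)| -
        critVal (δ / 2) * (σhat k ω * (√(k : ℝ) / √(N : ℝ))) < 0 := by
  have hN' : 0 < √(N : ℝ) := by positivity
  have hk' : 0 < √(k : ℝ) := by positivity
  have hc : 0 < √(k : ℝ) / (k * √(N : ℝ))⁻¹ := by positivity
  have hkk : (k : ℝ) = √(k : ℝ) * √(k : ℝ) := (Real.mul_self_sqrt (by positivity)).symm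
  have h1 : θ ∈ confInterval δ est σhat k ω ↔
      |est k ω - θ| < critVal (δ / 2) * σhat k ω / √(k : ℝ) := by
    rw [confInterval, Set.mem_Ioo, abs_lt]
    constructor <;> rintro ⟨h, h'⟩ <;> constructor <;> linarith
  rw [h1, sub_neg, abs_div, abs_mul, abs_of_pos hN', Nat.abs_cast, lt_div_iff₀ hk',
    div_lt_iff₀ hN']
  have h2 : critVal (δ / 2) * (σhat k ω * (√(k : ℝ) / √(N : ℝ))) * √(N : ℝ) =
      √(k : ℝ) * (critVal (δ / 2) * σhat k ω) := by field_simp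
  have h3 : (k : ℝ) * |est k ω - θ| = √(k : ℝ) * (|est k ω - θ| * √(k : ℝ)) := by
    nth_rewrite 1 [hkk]
    ring
  rw [h2, h3, mul_lt_mul_iff_right₀ hk']

/-- A deterministic sample size of the order `(c / ε)²`. -/
noncomputable def refSize (c ε : ℝ) : ℕ := ⌈(c / ε) ^ 2⌉₊ + 1

/-- The ceiling and the added one cost at most 2, so `c² ≤ ε² N ≤ c² + 2ε²`. -/
theorem tendsto_mul_sqrt_refSize {c : ℝ} (hc : 0 ≤ c) :
    Tendsto (fun ε => ε * √(refSize c ε : ℝ)) (𝓝[>] 0) (𝓝 c) := by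
  have hid : Tendsto (fun ε : ℝ => ε) (𝓝[>] 0) (𝓝 0) := nhdsWithin_le_nhds
  have h1 : Tendsto (fun ε : ℝ => ε ^ 2 * (refSize c ε : ℝ)) (𝓝[>] 0) (𝓝 (c ^ 2)) := by
    have hup : Tendsto (fun ε : ℝ => c ^ 2 + 2 * ε ^ 2) (𝓝[>] 0) (𝓝 (c ^ 2)) := by
      simpa using (((hid.pow 2).const_mul 2).const_add (c ^ 2))
    refine tendsto_of_tendsto_of_tendsto_of_le_of_le' tendsto_const_nhds hup ?_ ?_
    · filter_upwards [self_mem_nhdsWithin] with ε hε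
      have hε' : ε ≠ 0 := ne_of_gt hε
      have := Nat.le_ceil ((c / ε) ^ 2)
      calc c ^ 2 = ε ^ 2 * (c / ε) ^ 2 := by field_simp
        _ ≤ _ := by
          gcongr
          rw [refSize]
          push_cast
          linarith
    · filter_upwards [self_mem_nhdsWithin] with ε hε
      have hε' : ε ≠ 0 := ne_of_gt hε
      have := Nat.ceil_lt_add_one (sq_nonneg (c / ε))
      calc _ ≤ ε ^ 2 * ((c / ε) ^ 2 + 2) := by
            gcongr
            rw [refSize]
            push_cast
            linarith
        _ = _ := by field_simp
  have h2 := (Real.continuous_sqrt.tendsto _).comp h1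
  rw [Real.sqrt_sq hc] at h2
  refine h2.congr' ?_
  filter_upwards [self_mem_nhdsWithin] with ε hε
  simp only [Function.comp]
  rw [Real.sqrt_mul (sq_nonneg ε), Real.sqrt_sq (le_of_lt hε)]

theorem tendsto_refSize {c : ℝ} (hc : 0 < c) : Tendsto (refSize c) (𝓝[>] 0) atTop := by
  have h1 : Tendsto (fun ε : ℝ => (c * ε⁻¹) ^ 2) (𝓝[>] 0) atTop :=
    (tendsto_pow_atTop two_ne_zero).comp (tendsto_inv_nhdsGT_zero.const_mul_atTop hc)
  exact tendsto_atTop_mono (fun ε => Nat.le_succ _) (tendsto_nat_ceil_atTop.comp h1)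

/-! ### The coverage probability -/

theorem _root_.MeasureTheory.TendstoInDistribution.comp_tendsto {Ω Ω' E ι κ : Type*}
    [MeasurableSpace Ω] [MeasurableSpace Ω'] [MeasurableSpace E] [TopologicalSpace E]
    [OpensMeasurableSpace E] {P : Measure Ω} [IsProbabilityMeasure P] {P' : Measure Ω'}
    [IsProbabilityMeasure P'] {X : ι → Ω → E} {Z : Ω' → E} {l : Filter ι} {l' : Filter κ}
    (h : TendstoInDistribution X l Z (fun _ => P) P') {u : κ → ι} (hu : Tendsto u l' l) :
    TendstoInDistribution (fun k => X (u k)) l' Z (fun _ => P) P' :=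
  ⟨fun k => h.forall_aemeasurable (u k), h.aemeasurable_limit, h.tendsto.comp hu⟩

/-- If `W` converges in distribution to a limit without atom at `0`, then the probabilities that
`W` is negative converge. -/
theorem _root_.MeasureTheory.TendstoInDistribution.tendsto_measureReal_neg {Ω Ω' ι : Type*}
    [MeasurableSpace Ω] [MeasurableSpace Ω'] {P : Measure Ω} [IsProbabilityMeasure P]
    {P' : Measure Ω'} [IsProbabilityMeasure P'] {W : ι → Ω → ℝ} {Z : Ω' → ℝ} {l : Filter ι}
    (h : TendstoInDistribution W l Z (fun _ => P) P') (hZ : P' {ω | Z ω = 0} = 0) :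
    Tendsto (fun i => P.real {ω | W i ω < 0}) l (𝓝 (P'.real {ω | Z ω < 0})) := by
  have hfr : (P'.map Z) (frontier (Set.Iio 0)) = 0 := by
    rw [frontier_Iio, Measure.map_apply_of_aemeasurable h.aemeasurable_limit
      (measurableSet_singleton 0)]
    exact hZ
  have := ProbabilityMeasure.tendsto_measure_of_null_frontier_of_tendsto' h.tendsto hfr
  simp only [ProbabilityMeasure.coe_mk] at this
  rw [Measure.map_apply_of_aemeasurable h.aemeasurable_limit measurableSet_Iio] at this
  refine ((ENNReal.tendsto_toReal (measure_ne_top _ _)).comp this).congr fun i => ?_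
  simp only [Function.comp]
  rw [Measure.map_apply_of_aemeasurable (h.forall_aemeasurable i) measurableSet_Iio]
  rfl

/-- The coverage of intervals at random sample sizes `T ε` that are asymptotically equivalent to
deterministic ones. -/
theorem tendsto_coverage [MeasurableSpace Ω] {P : Measure Ω} [IsProbabilityMeasure P]
    {est σhat : ℕ → Ω → ℝ} {θ σ δ : ℝ} (hest : ∀ n, Measurable (est n))
    (hσhat : ∀ n, Measurable (σhat n)) (hδ : δ ∈ Set.Ioo (0 : ℝ) 1) (hσ : 0 < σ)
    (hFCLT : FunctionalCLT P est θ σ)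
    (hσ_lim : ∀ᵐ ω ∂P, Tendsto (fun n => σhat n ω) atTop (𝓝 σ))
    {ι : Type*} {l : Filter ι} [l.IsCountablyGenerated] {T : ι → Ω → ℕ} {N : ι → ℕ}
    (hT : ∀ i, Measurable (T i)) (hT1 : ∀ i ω, T i ω ≠ 0) (hN1 : ∀ i, N i ≠ 0)
    (hN : Tendsto N l atTop) (hT_lim : ∀ᵐ ω ∂P, Tendsto (fun i => T i ω) l atTop)
    (hTN : ∀ᵐ ω ∂P, Tendsto (fun i => √(T i ω : ℝ) / √(N i : ℝ)) l (𝓝 1)) :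
    Tendsto (fun i => P.real {ω | θ ∈ confInterval δ est σhat (T i ω) ω}) l (𝓝 (1 - δ)) := by
  obtain ⟨ν, hB, hconv⟩ := hFCLT
  have : LocallyCompactSpace (Set.Ioi (0 : ℝ≥0)) := isOpen_Ioi.locallyCompactSpace
  set z := critVal (δ / 2) with hz
  have hz0 : 0 < z := critVal_pos ⟨by linarith [hδ.1], by linarith [hδ.2]⟩
  have hpos : ∀ i ω, ((T i ω : ℕ) : ℝ≥0) / (N i : ℝ≥0) ∈ Set.Ioi 0 := fun i ω =>
    Set.mem_Ioi.2 (div_pos (Nat.cast_pos.2 (Nat.pos_of_ne_zero (hT1 i ω)))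
      (Nat.cast_pos.2 (Nat.pos_of_ne_zero (hN1 i))))
  have hcast : ∀ i, Measurable fun ω => ((T i ω : ℕ) : ℝ) := fun i =>
    measurable_from_nat.comp (hT i)
  let τ : ι → Ω → Set.Ioi (0 : ℝ≥0) := fun i ω => ⟨((T i ω : ℕ) : ℝ≥0) / (N i : ℝ≥0), hpos i ω⟩
  let one : Set.Ioi (0 : ℝ≥0) := ⟨1, Set.mem_Ioi.2 one_pos⟩
  have hτ : TendstoInMeasure P τ l (fun _ => one) := by
    refine tendstoInMeasure_of_tendsto_ae_filter (fun i => ?_) ?_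
    · refine (Measurable.subtype_mk ?_).aestronglyMeasurable
      exact (measurable_from_nat.comp (hT i)).div_const _
    · filter_upwards [hTN] with ω hω
      rw [tendsto_subtype_rng, ← NNReal.tendsto_coe]
      have := hω.pow 2
      simp only [one_pow, div_pow] at this
      refine this.congr fun i => ?_
      rw [Real.sq_sqrt (by positivity), Real.sq_sqrt (by positivity)]
      simp [τ]
  have hY := hconv.comp_tendsto hN
  have hY1 := hY.continuous_comp (g := fun f : C(Set.Ioi (0 : ℝ≥0), ℝ) => f one)
    (by fun_prop)
  have hV_eq : ∀ i ω, errorProcess est θ (N i) ω (τ i ω) =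
      T i ω * (est (T i ω) ω - θ) / √(N i : ℝ) := fun i ω =>
    errorProcess_apply_div est θ (hN1 i) (T i ω) ω (hpos i ω)
  -- Moving the evaluation time from `1` to the random `τ` changes the value by a term that vanishes
  -- in probability.
  have hV : TendstoInDistribution
      (fun i ω => T i ω * (est (T i ω) ω - θ) / √(N i : ℝ)) l
      (fun w : C(ℝ≥0, ℝ) => σ * w 1) (fun _ => P) (ν : Measure C(ℝ≥0, ℝ)) := by
    refine tendstoInDistribution_of_tendstoInMeasure_sub _ _ hY1 ?_ fun i => ?_
    · refine (tendstoInMeasure_eval_sub_eval hY hτ).congr_left fun i => .of_forall fun ω => ?_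
      simp only [hV_eq, Pi.sub_apply, Function.comp]
    · exact (((hcast i).mul ((measurable_eval_nat hest (hT i)).sub_const θ)).div_const
        _).aemeasurable
  have hR_meas : ∀ i, Measurable fun ω =>
      σhat (T i ω) ω * (√(T i ω : ℝ) / √(N i : ℝ)) := fun i =>
    (measurable_eval_nat hσhat (hT i)).mul ((hcast i).sqrt.div_const _)
  have hR : TendstoInMeasure P (fun i ω => σhat (T i ω) ω * (√(T i ω : ℝ) / √(N i : ℝ))) l
      (fun _ => σ) := by
    refine tendstoInMeasure_of_tendsto_ae_filter (fun i => (hR_meas i).aestronglyMeasurable) ?_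
    filter_upwards [hσ_lim, hT_lim, hTN] with ω h1 h2 h3
    simpa using (h1.comp h2).mul h3
  -- Slutsky: the half-width factor has a constant limit, so it converges jointly with the error
  -- term.
  have hW := hV.continuous_comp_prodMk_of_tendstoInMeasure_const
    (g := fun x : ℝ × ℝ => |x.1| - z * x.2) (by fun_prop) hR (fun i => (hR_meas i).aemeasurable)
  have hlaw : (ν : Measure C(ℝ≥0, ℝ)).map (fun w => w 1) = gaussianReal 0 1 :=
    (hB.hasLaw_eval 1).map_eq
  have hmeas1 : Measurable fun w : C(ℝ≥0, ℝ) => w 1 :=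
    (by fun_prop : Continuous fun w : C(ℝ≥0, ℝ) => w 1).measurable
  have habs : ∀ w : C(ℝ≥0, ℝ), |σ * w 1| - z * σ = σ * (|w 1| - z) := fun w => by
    rw [abs_mul, abs_of_pos hσ]; ring
  have hnull : (ν : Measure C(ℝ≥0, ℝ)) {w | |σ * w 1| - z * σ = 0} = 0 := by
    have := nullSingletonClass_stdGaussian
    have hsub : {w : C(ℝ≥0, ℝ) | |σ * w 1| - z * σ = 0} ⊆ (fun w => w 1) ⁻¹' {z, -z} := by
      intro w hw
      simp only [Set.mem_ofPred_eq, habs, mul_eq_zero, hσ.ne', false_or, sub_eq_zero] at hw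
      exact (abs_eq hz0.le).1 hw
    refine measure_mono_null hsub ?_
    rw [← Measure.map_apply hmeas1 (Set.toFinite _).measurableSet, hlaw]
    exact (Set.toFinite _).measure_zero _
  have hlim : (ν : Measure C(ℝ≥0, ℝ)).real {w | |σ * w 1| - z * σ < 0} = 1 - δ := by
    have hset : {w : C(ℝ≥0, ℝ) | |σ * w 1| - z * σ < 0} = (fun w => w 1) ⁻¹' Set.Ioo (-z) z := by
      ext w
      simp only [Set.mem_ofPred_eq, habs, Set.mem_preimage, Set.mem_Ioo, ← abs_lt]
      rw [← sub_neg (a := |w 1|)]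
      exact ⟨fun h => neg_of_mul_neg_right h hσ.le, fun h => mul_neg_of_pos_of_neg hσ h⟩
    rw [hset, ← map_measureReal_apply hmeas1 measurableSet_Ioo, hlaw,
      stdGaussian_real_Ioo_critVal hδ]
  rw [← hlim]
  refine (hW.tendsto_measureReal_neg hnull).congr fun i => ?_
  congr 1
  ext ω
  exact (mem_confInterval_iff (hN1 i) (hT1 i ω)).symm

end FixedWidth

/-! ### Assembly of the theorem -/

open FixedWidth in
theorem theorem1 {Ω : Type*} [MeasurableSpace Ω] (P : Measure Ω) [IsProbabilityMeasure P]
    (est σhat lamhat : ℕ → Ω → ℝ) (θ σ lam δ : ℝ) (p : ℕ → ℝ)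
    (hest : ∀ n, Measurable (est n)) (hσhat : ∀ n, Measurable (σhat n))
    (hlamhat : ∀ n, Measurable (lamhat n))
    (hσhat_nonneg : ∀ n, ∀ᵐ ω ∂P, 0 ≤ σhat n ω)
    (hδ : δ ∈ Set.Ioo (0 : ℝ) 1) (hσ : 0 < σ) (hlam : 0 < lam)
    (hp_pos : ∀ n, 1 ≤ n → 0 < p n)
    (hp : p =o[atTop] fun n : ℕ => (n : ℝ) ^ (-(1 / 2) : ℝ))
    (hFCLT : FunctionalCLT P est θ σ)
    (hlam_lim : ∀ᵐ ω ∂P, Tendsto (fun n => lamhat n ω) atTop (𝓝 lam))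
    (hσ_lim : ∀ᵐ ω ∂P, Tendsto (fun n => σhat n ω) atTop (𝓝 σ)) :
    (∀ᵐ ω ∂P, ∀ ε : ℝ, 0 < ε → T₃ δ σhat lamhat p ε ω < ⊤) ∧
    Tendsto
      (fun ε : ℝ => P.real {ω | ∃ n : ℕ, T₃ δ σhat lamhat p ε ω = n ∧
        θ ∈ confInterval δ est σhat n ω})
      (𝓝[>] 0) (𝓝 (1 - δ)) := by
  have hz : 0 < critVal (δ / 2) := critVal_pos ⟨by linarith [hδ.1], by linarith [hδ.2]⟩
  set c : ℝ := 2 * critVal (δ / 2) * σ / lam with hc_def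
  have hc : 0 < c := by positivity
  let S : ℝ → Ω → Set ℕ := fun ε ω =>
    stopSet (ruleWidth (critVal (δ / 2)) (fun n => σhat n ω) p) (fun n => lamhat n ω) ε
  have hS_meas : ∀ ε n, MeasurableSet {ω | n ∈ S ε ω} := fun ε n => by
    refine (MeasurableSet.const _).inter (measurableSet_le ?_ ((hlamhat n).const_mul ε))
    exact (((hσhat n).const_mul _).div_const _).add_const _
  have hT_meas : ∀ ε, Measurable fun ω => sInf (S ε ω) := fun ε => measurable_sInf_nat (hS_meas ε)
  -- The argument is pathwise, so one null set serves all `ε > 0`.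
  have hne : ∀ᵐ ω ∂P, ∀ ε : ℝ, 0 < ε → (S ε ω).Nonempty := by
    filter_upwards [hlam_lim, hσ_lim] with ω h1 h2 ε hε
    exact stopSet_nonempty (tendsto_sqrt_mul_ruleWidth _ h2 hp) h1 hlam hε
  refine ⟨?_, ?_⟩
  · filter_upwards [hne] with ω hω ε hε
    rw [T₃_eq_sInf (hω ε hε)]
    exact ENat.natCast_lt_top _
  have hpos : ∀ᵐ ω ∂P, ∀ n, 1 ≤ n →
      0 < ruleWidth (critVal (δ / 2)) (fun n => σhat n ω) p n := by
    filter_upwards [ae_all_iff.2 hσhat_nonneg] with ω h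
    exact ruleWidth_pos hz.le h hp_pos
  have hmax : ∀ᵐ ω ∂P, ∀ ε : ℝ, 0 < ε → max 1 (sInf (S ε ω)) = sInf (S ε ω) := by
    filter_upwards [hne] with ω hω ε hε
    exact max_eq_right (Nat.sInf_mem (hω ε hε)).1
  -- `max 1` makes the sample size nonzero everywhere; `sInf` is `0` where the stopping set is
  -- empty, a null event for `ε > 0`.
  have key := tendsto_coverage hest hσhat hδ hσ hFCLT hσ_lim (l := 𝓝[>] (0 : ℝ))
    (T := fun ε ω => max 1 (sInf (S ε ω))) (N := refSize c)
    (fun ε => measurable_const.max (hT_meas ε)) (fun ε ω => by positivity)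
    (fun ε => Nat.succ_ne_zero _) (tendsto_refSize hc) ?_ ?_
  · refine key.congr' ?_
    filter_upwards [self_mem_nhdsWithin] with ε hε
    refine measureReal_congr ?_
    filter_upwards [hne, hmax] with ω h1 h2
    refine propext ?_
    change θ ∈ confInterval δ est σhat (max 1 (sInf (S ε ω))) ω ↔
      ∃ n : ℕ, T₃ δ σhat lamhat p ε ω = n ∧ θ ∈ confInterval δ est σhat n ω
    rw [T₃_eq_sInf (h1 ε hε), h2 ε hε]
    simp only [Nat.cast_inj, exists_eq_left', S]
  · filter_upwards [hpos, hlam_lim, hσ_lim] with ω h1 h2 h3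
    exact tendsto_atTop_mono (fun ε => le_max_right _ _)
      (tendsto_sInf_stopSet h1 (tendsto_sqrt_mul_ruleWidth _ h3 hp) h2 hlam)
  · filter_upwards [hpos, hlam_lim, hσ_lim, hmax] with ω h1 h2 h3 h4
    have h := (tendsto_mul_sqrt_sInf_stopSet h1 (tendsto_sqrt_mul_ruleWidth _ h3 hp) h2 hlam).div
      (tendsto_mul_sqrt_refSize hc.le) hc.ne'
    rw [← hc_def, div_self hc.ne'] at h
    refine h.congr' ?_
    filter_upwards [self_mem_nhdsWithin] with ε hε
    rw [h4 ε hε, Pi.div_apply, mul_div_mul_left _ _ (ne_of_gt hε)]
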